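/- Let $L,R\ge 0$ and $N\in\mathbb N=\{0,1,2,\dots\}$. Define $\theta_0=1$, $\theta_{i+1}=\tfrac12\bigl(1+\sqrt{4\theta_i^2+1}\bigr)$ for $0\le i\le N-2$, and, if $N\ge1$, $\theta_N=\tfrac12\bigl(1+\sqrt{8\theta_{N-1}^2+1}\bigr)$ (the numbers $\theta_i=\theta_{i,N}$ depend on $N$). Call $(f,x_0)$ an input in dimension $d$ if $f:\mathbb R^d\to\mathbb R$ is convex and differentiable with $\|\nabla f(x)-\nabla f(y)\|\le L\|x-y\|$ for all $x,y\in\mathbb R^d$, $x_0\in\mathbb R^d$, and $\|x_0-x_*\|\le R$ for some minimizer $x_*$ of $f$; put $f_*=\min f$. For points $x_0,\dots,x_N$ let $f'(x_i)\in\partial f(x_i)$ denote a subgradient of $f$ at $x_i$ (for such $f$ it is the gradient). If $L=0$ (so that $f$ is constant), $1/L$ and $2/L$ are read as $0$. The greedy first-order method (GFOM), run on $(f,x_0)$ for $N$ iterations, chooses for $i=1,\dots,N$ $$x_i\in\operatorname{argmin}\{f(x): x\in x_0+\operatorname{span}\{f'(x_0),\dots,f'(x_{i-1})\}\}$$ and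 $f'(x_i)\in\partial f(x_i)$ with $\langle f'(x_i),f'(x_j)\rangle=0$ for all $0\le j<i$; its output is $x_N$ (there is no output if some argmin is empty). 1. For every $d$, every input $(f,x_0)$ in dimension $d$ and every output $x_N$ of GFOM on it, $$f(x_N)-f_*\le\frac{LR^2}{2\theta_N^2}.$$ This bound is tight when $d\ge 2N+2$: for every such $d$ and every $\varepsilon>0$ there are an input $(f,x_0)$ in dimension $d$ and an execution of GFOM on it whose output satisfies $f(x_N)-f_*\ge\frac{LR^2}{2\theta_N^2}-\varepsilon$. 2. For every $d$, every input $(f,x_0)$ in dimension $d$ and every sequence $x_1,\dots,x_N$ in $\mathbb R^d$ with $$\Bigl\langle f'(x_i),\,x_i-\Bigl[\bigl(1-\tfrac1{\theta_i}\bigr)\bigl(x_{i-1}-\tfrac1Lf'(x_{i-1})\bigr)+\tfrac1{\theta_i}\Bigl(x_0-\tfrac2L\sum_{j=0}^{i-1}\theta_jf'(x_j)\Bigr)\Bigr]\Bigr\rangle=0,\qquad i=1,\dots,N,\tag{$*$}$$ one has $f(x_N)-f_*\le\frac{LR^2}{2\theta_N^2}$. 3. For $i\ge 1$ put $y_i=(1-\frac1{\theta_i})x_{i-1}+\frac1{\theta_i}x_0$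 and $d_i=(1-\frac1{\theta_i})f'(x_{i-1})+\frac2{\theta_i}\sum_{j=0}^{i-1}\theta_jf'(x_j)$. For every input $(f,x_0)$, every sequence generated from $x_0$ by the optimized gradient method (OGM), $x_i=y_i-\frac1Ld_i$ for $i=1,\dots,N$, and every sequence generated from $x_0$ by OGM with exact line search, $x_i=y_i-\alpha_id_i$ with $\alpha_i\in\operatorname{argmin}_{\alpha\in\mathbb R}f(y_i-\alpha d_i)$ for $i=1,\dots,N$, satisfies $(*)$, and hence $f(x_N)-f_*\le\frac{LR^2}{2\theta_N^2}$. -/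

import Mathlib

noncomputable section

/-- The sequence `θ_{i,N}` for `0 ≤ i ≤ N` (argument order: `N`, then `i`); the last step, `i + 1 = N`,
uses the factor `8` and all earlier ones the factor `4`. In particular `θ_{0,0} = 1`. -/
def ogmTheta (N : ℕ) : ℕ → ℝ
  | 0 => 1
  | i + 1 =>
    if i + 1 = N then (1 + Real.sqrt (8 * ogmTheta N i ^ 2 + 1)) / 2
    else (1 + Real.sqrt (4 * ogmTheta N i ^ 2 + 1)) / 2

/-- The subdifferential of a real-valued convex function `f` at `x`. -/
def subdiff {d : ℕ} (f : EuclideanSpace ℝ (Fin d) → ℝ) (x : EuclideanSpace ℝ (Fin d)) :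
    Set (EuclideanSpace ℝ (Fin d)) :=
  {g | ∀ y, f x + inner ℝ g (y - x) ≤ f y}

/-- The class `F_{0,L}(ℝ^d)` of `L`-smooth convex functions: convex, differentiable,
with an `L`-Lipschitz gradient. -/
def smoothConvex (d : ℕ) (L : ℝ) : Set (EuclideanSpace ℝ (Fin d) → ℝ) :=
  {f | ConvexOn ℝ Set.univ f ∧ Differentiable ℝ f ∧
    ∀ x y, ‖gradient f x - gradient f y‖ ≤ L * ‖x - y‖}

/-- `(f, x₀)` is an `(F, R)`-input: `f ∈ F` and `x₀` is at distance at most `R` from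
some minimizer of `f`. -/
def IsInput {d : ℕ} (F : Set (EuclideanSpace ℝ (Fin d) → ℝ)) (R : ℝ)
    (f : EuclideanSpace ℝ (Fin d) → ℝ) (x₀ : EuclideanSpace ℝ (Fin d)) : Prop :=
  f ∈ F ∧ ∃ xs, (∀ y, f xs ≤ f y) ∧ ‖x₀ - xs‖ ≤ R

/-- `x 0, …, x N` starts at `x₀`, and `g i ∈ ∂f(x i)` plays the role of `f'(x i)`
for `i = 0, …, N`. Entries of index larger than `N` are irrelevant. -/
def IsTrajectory {d : ℕ} (f : EuclideanSpace ℝ (Fin d) → ℝ) (x₀ : EuclideanSpace ℝ (Fin d))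
    (N : ℕ) (x g : ℕ → EuclideanSpace ℝ (Fin d)) : Prop :=
  x 0 = x₀ ∧ ∀ i ≤ N, g i ∈ subdiff f (x i)

/-- `x, g` is an execution of the greedy first-order method with `N` iterations on `(f, x₀)`;
its output is `x N`. -/
def IsGFOM {d : ℕ} (f : EuclideanSpace ℝ (Fin d) → ℝ) (x₀ : EuclideanSpace ℝ (Fin d))
    (N : ℕ) (x g : ℕ → EuclideanSpace ℝ (Fin d)) : Prop :=
  IsTrajectory f x₀ N x g ∧
  ∀ i, 1 ≤ i → i ≤ N →
    (x i - x₀ ∈ Submodule.span ℝ (g '' Set.Iio i) ∧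
      ∀ y, y - x₀ ∈ Submodule.span ℝ (g '' Set.Iio i) → f (x i) ≤ f y) ∧
    ∀ j < i, inner ℝ (g i) (g j) = 0

/-- The orthogonality relations
`⟨g_i, x_i - [(1 - 1/θ_i)(x_{i-1} - g_{i-1}/L) + (1/θ_i)(x_0 - (2/L) ∑_{j<i} θ_j g_j)]⟩ = 0`,
`i = 1, …, N`. -/
def SatisfiesOGMRelation {d : ℕ} (L : ℝ) (N : ℕ) (x g : ℕ → EuclideanSpace ℝ (Fin d)) : Prop :=
  ∀ i, 1 ≤ i → i ≤ N →
    inner ℝ (g i)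
      (x i - ((1 - 1 / ogmTheta N i) • (x (i - 1) - (1 / L) • g (i - 1)) +
        (1 / ogmTheta N i) •
          (x 0 - (2 / L) • ∑ j ∈ Finset.range i, ogmTheta N j • g j))) = 0

/-- `y_i = (1 - 1/θ_i) x_{i-1} + (1/θ_i) x_0`, for `i ≥ 1`. -/
def ogmY {d : ℕ} (N : ℕ) (x : ℕ → EuclideanSpace ℝ (Fin d)) (i : ℕ) :
    EuclideanSpace ℝ (Fin d) :=
  (1 - 1 / ogmTheta N i) • x (i - 1) + (1 / ogmTheta N i) • x 0

/-- `d_i = (1 - 1/θ_i) g_{i-1} + (2/θ_i) ∑_{j<i} θ_j g_j`, for `i ≥ 1`. -/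
def ogmD {d : ℕ} (N : ℕ) (g : ℕ → EuclideanSpace ℝ (Fin d)) (i : ℕ) :
    EuclideanSpace ℝ (Fin d) :=
  (1 - 1 / ogmTheta N i) • g (i - 1) +
    (2 / ogmTheta N i) • ∑ j ∈ Finset.range i, ogmTheta N j • g j

/-- An execution of the optimized gradient method: `x_i = y_i - d_i / L`. -/
def IsOGM {d : ℕ} (L : ℝ) (f : EuclideanSpace ℝ (Fin d) → ℝ) (x₀ : EuclideanSpace ℝ (Fin d))
    (N : ℕ) (x g : ℕ → EuclideanSpace ℝ (Fin d)) : Prop :=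
  IsTrajectory f x₀ N x g ∧
  ∀ i, 1 ≤ i → i ≤ N → x i = ogmY N x i - (1 / L) • ogmD N g i

/-- An execution of the optimized gradient method with exact line search:
`x_i = y_i - α d_i` with `α ∈ argmin_β f(y_i - β d_i)`. -/
def IsOGMLS {d : ℕ} (f : EuclideanSpace ℝ (Fin d) → ℝ) (x₀ : EuclideanSpace ℝ (Fin d))
    (N : ℕ) (x g : ℕ → EuclideanSpace ℝ (Fin d)) : Prop :=
  IsTrajectory f x₀ N x g ∧
  ∀ i, 1 ≤ i → i ≤ N → ∃ α : ℝ,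
    (∀ β : ℝ, f (ogmY N x i - α • ogmD N g i) ≤ f (ogmY N x i - β • ogmD N g i)) ∧
    x i = ogmY N x i - α • ogmD N g i

end

/-! Upper bound. Relation (*) is all the proof uses about the method. With z_i = `ogmZ L N x g i`,
weight the interpolation inequality for the pair (x_{i+1}, x_i) by θ² - θ and for (x_{i+1}, x_*) by
θ, where θ = θ_{i+1}; (*) eliminates x_{i+1} (`combination_le`). Since θ² - θ = θ_i² before the last
step, the potential 2θ_i²(f(x_i) - f_* - ‖g_i‖²/(2L)) + (L/2)‖z_{i+1} - x_*‖² never increases. The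
factor 8 in θ_N makes the last combination match this potential, and completing a square gives the
bound. GFOM and both forms of OGM satisfy (*).

Tightness. A piecewise affine function with orthogonal slopes g_0, …, g_N is smoothed by its Moreau
envelope (`exists_envelope`), so that the greedy method meets the slopes one at a time
(`exists_isGFOM`). Levels and slope lengths come from θ so that both the squared distance to the
minimizer and the final gap are explicit. The construction only needs dimension N + 1. -/

theorem nonneg_of_forall_nonneg_add_mul {b K : ℝ}
    (h : ∀ s : ℝ, 0 < s → s ≤ 1 → 0 ≤ b + K * s) : 0 ≤ b := by
  by_contra hb
  push Not at hb
  have hK : 0 < |K| - b := by have := abs_nonneg K; linarith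
  -- This s gives K s ≤ -b/2, hence b + K s ≤ b/2 < 0.
  have hs : 0 < -b / (2 * (|K| - b)) := by apply div_pos <;> linarith
  have h1 := h (-b / (2 * (|K| - b))) hs (by
    rw [div_le_one (by linarith)]; have := abs_nonneg K; linarith)
  have h2 : K * (-b / (2 * (|K| - b))) ≤ (|K| - b) * (-b / (2 * (|K| - b))) :=
    mul_le_mul_of_nonneg_right (by have := le_abs_self K; linarith) hs.le
  have h3 : (|K| - b) * (-b / (2 * (|K| - b))) = -b / 2 := by field_simp
  linarith

/-! ### The recursion for θ -/

section Theta

theorem one_le_ogmTheta (N i : ℕ) : 1 ≤ ogmTheta N i := by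
  induction i with
  | zero => simp [ogmTheta]
  | succ i ih =>
    have h : ∀ c : ℝ, 0 ≤ c → 1 ≤ Real.sqrt (c * ogmTheta N i ^ 2 + 1) := fun c hc =>
      Real.one_le_sqrt.2 (by have := mul_nonneg hc (sq_nonneg (ogmTheta N i)); linarith)
    rw [ogmTheta]
    split_ifs
    · have := h 8 (by norm_num); linarith
    · have := h 4 (by norm_num); linarith

/-- Each θ is the larger root of a quadratic equation; this equation, rather than the square root,
is what makes both halves of the proof telescope. -/
theorem ogmTheta_succ_sq {N i : ℕ} (h : i + 1 ≠ N) :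
    ogmTheta N (i + 1) ^ 2 - ogmTheta N (i + 1) = ogmTheta N i ^ 2 := by
  have hs := Real.sq_sqrt (show 0 ≤ 4 * ogmTheta N i ^ 2 + 1 by positivity)
  rw [ogmTheta, if_neg h]
  nlinarith

theorem ogmTheta_last_sq {N i : ℕ} (h : i + 1 = N) :
    ogmTheta N (i + 1) ^ 2 - ogmTheta N (i + 1) = 2 * ogmTheta N i ^ 2 := by
  have hs := Real.sq_sqrt (show 0 ≤ 8 * ogmTheta N i ^ 2 + 1 by positivity)
  rw [ogmTheta, if_pos h]
  nlinarith

end Theta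

/-! ### Inequalities for smooth convex functions -/

section SmoothConvex

variable {d : ℕ} {L : ℝ} {f : EuclideanSpace ℝ (Fin d) → ℝ}

/-- The descent lemma. -/
theorem smoothConvex.le_quadratic (hf : f ∈ smoothConvex d L) (x y : EuclideanSpace ℝ (Fin d)) :
    f y ≤ f x + inner ℝ (gradient f x) (y - x) + L / 2 * ‖y - x‖ ^ 2 := by
  obtain ⟨-, hd, hl⟩ := hf
  set v := y - x with hv
  let h : ℝ → ℝ := fun s => f (x + s • v) - s * inner ℝ (gradient f x) v - L / 2 * ‖v‖ ^ 2 * s ^ 2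
  have hder : ∀ s, HasDerivAt h (inner ℝ (gradient f (x + s • v)) v - inner ℝ (gradient f x) v
      - L / 2 * ‖v‖ ^ 2 * (2 * s)) s := by
    intro s
    have h1 : HasDerivAt (fun s : ℝ => x + s • v) v s := by
      simpa using ((hasDerivAt_id s).smul_const v).const_add x
    have h2 := ((hd (x + s • v)).hasGradientAt.hasFDerivAt).comp_hasDerivAt s h1
    have h3 := (hasDerivAt_id s).mul_const (inner ℝ (gradient f x) v)
    have h4 := ((hasDerivAt_id s).pow 2).const_mul (L / 2 * ‖v‖ ^ 2)
    refine ((h2.sub h3).sub h4).congr_deriv ?_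
    simp
  have hanti : AntitoneOn h (Set.Icc 0 1) := by
    refine antitoneOn_of_deriv_nonpos (convex_Icc 0 1)
      (fun s _ => (hder s).continuousAt.continuousWithinAt)
      (fun s _ => (hder s).differentiableAt.differentiableWithinAt) fun s hs => ?_
    rw [interior_Icc] at hs
    rw [(hder s).deriv, ← inner_sub_left]
    have h1 := real_inner_le_norm (gradient f (x + s • v) - gradient f x) v
    have h2 := hl (x + s • v) x
    rw [add_sub_cancel_left, norm_smul, Real.norm_of_nonneg hs.1.le] at h2
    have h3 := mul_le_mul_of_nonneg_right h2 (norm_nonneg v)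
    nlinarith
  have := hanti (Set.left_mem_Icc.2 zero_le_one) (Set.right_mem_Icc.2 zero_le_one) zero_le_one
  simp only [h, hv, one_smul, zero_smul, add_sub_cancel, add_zero] at this
  linarith

/-- Moving by -s(∇f(x) - g), the linear lower bound with slope g and the quadratic upper bound are
compatible for small s only if the two slopes agree. -/
theorem smoothConvex.eq_gradient (hf : f ∈ smoothConvex d L) {x g : EuclideanSpace ℝ (Fin d)}
    (hg : g ∈ subdiff f x) : g = gradient f x := by
  set w := gradient f x - g with hw
  have key : 0 ≤ -(‖w‖ ^ 2) := by
    refine nonneg_of_forall_nonneg_add_mul (K := L / 2 * ‖w‖ ^ 2) fun s hs _ => ?_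
    have h1 := hg (x - s • w)
    have h2 := smoothConvex.le_quadratic hf x (x - s • w)
    have e : x - s • w - x = -(s • w) := by abel
    rw [e, inner_neg_right, inner_smul_right] at h1 h2
    rw [norm_neg, norm_smul, Real.norm_of_nonneg hs.le] at h2
    have h3 : inner ℝ (gradient f x) w - inner ℝ g w = ‖w‖ ^ 2 := by
      rw [← inner_sub_left, ← hw, real_inner_self_eq_norm_sq]
    have h4 : 0 ≤ s * (-(‖w‖ ^ 2) + L / 2 * ‖w‖ ^ 2 * s) := by
      have h5 := congrArg (s * ·) h3
      linarith
    exact nonneg_of_mul_nonneg_right h4 hs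
  have : ‖w‖ = 0 := by nlinarith [norm_nonneg w]
  exact (sub_eq_zero.1 (norm_eq_zero.1 this)).symm

theorem smoothConvex.le_quadratic_of_mem_subdiff (hf : f ∈ smoothConvex d L)
    {x g : EuclideanSpace ℝ (Fin d)} (hg : g ∈ subdiff f x) (y : EuclideanSpace ℝ (Fin d)) :
    f y ≤ f x + inner ℝ g (y - x) + L / 2 * ‖y - x‖ ^ 2 :=
  smoothConvex.eq_gradient hf hg ▸ smoothConvex.le_quadratic hf x y

/-- The interpolation inequality of smooth convex functions. -/
theorem smoothConvex.cocoercive (hL : 0 < L) (hf : f ∈ smoothConvex d L)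
    {x y g h : EuclideanSpace ℝ (Fin d)} (hg : g ∈ subdiff f x) (hh : h ∈ subdiff f y) :
    f x + inner ℝ g (y - x) + (1 / L) / 2 * ‖g - h‖ ^ 2 ≤ f y := by
  -- The test point minimizes the quadratic upper model at y minus the affine lower model at x.
  have h1 := hg (y + (1 / L) • (g - h))
  have h2 := smoothConvex.le_quadratic_of_mem_subdiff hf hh (y + (1 / L) • (g - h))
  have e : y + (1 / L) • (g - h) - x = (y - x) + (1 / L) • (g - h) := by abel
  rw [add_sub_cancel_left, norm_smul, inner_smul_right, Real.norm_of_nonneg (by positivity)] at h2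
  rw [e, inner_add_right, inner_smul_right] at h1
  have h3 : inner ℝ g (g - h) - inner ℝ h (g - h) = ‖g - h‖ ^ 2 := by
    rw [← inner_sub_left, real_inner_self_eq_norm_sq]
  have h4 : L / 2 * (1 / L * ‖g - h‖) ^ 2 = 1 / L / 2 * ‖g - h‖ ^ 2 := by field_simp
  rw [h4] at h2
  have h5 : 1 / L * inner ℝ g (g - h) - 1 / L * inner ℝ h (g - h) = 1 / L * ‖g - h‖ ^ 2 := by
    rw [← h3]; ring
  linarith

theorem smoothConvex.inner_eq_zero_of_line_min (hf : f ∈ smoothConvex d L)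
    {x g v : EuclideanSpace ℝ (Fin d)} (hg : g ∈ subdiff f x) (hmin : ∀ s : ℝ, f x ≤ f (x + s • v)) :
    inner ℝ g v = 0 := by
  have key : ∀ w, (∀ s : ℝ, f x ≤ f (x + s • w)) → 0 ≤ inner ℝ g w := fun w hw => by
    refine nonneg_of_forall_nonneg_add_mul (K := L / 2 * ‖w‖ ^ 2) fun s hs _ => ?_
    have h2 := smoothConvex.le_quadratic_of_mem_subdiff hf hg (x + s • w)
    rw [add_sub_cancel_left, norm_smul, inner_smul_right, Real.norm_of_nonneg hs.le] at h2
    have h4 : 0 ≤ s * (inner ℝ g w + L / 2 * ‖w‖ ^ 2 * s) := by nlinarith [hw s]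
    exact nonneg_of_mul_nonneg_right h4 hs
  have h1 := key v hmin
  have h2 := key (-v) fun s => by simpa using hmin (-s)
  rw [inner_neg_right] at h2
  linarith

end SmoothConvex

/-! ### The potential argument -/

section UpperBound

variable {E : Type*} [NormedAddCommGroup E] [InnerProductSpace ℝ E]

/-- The one-step identity behind the potential function of the optimized gradient method. -/
theorem ogm_step_identity {θ M : ℝ} (hθ : θ ≠ 0) (g g' x x' z xs : E)
    (h : inner ℝ g (x - ((1 - 1 / θ) • (x' - M • g') + (1 / θ) • z)) = 0) :
    (θ ^ 2 - θ) * (inner ℝ g (x' - x) + M / 2 * ‖g - g'‖ ^ 2)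
      + θ * (inner ℝ g (xs - x) + M / 2 * ‖g‖ ^ 2)
      = (θ ^ 2 - θ) * (M / 2 * ‖g'‖ ^ 2) + θ ^ 2 * (M / 2 * ‖g‖ ^ 2) - θ * inner ℝ g (z - xs) := by
  have h' : θ ^ 2 * inner ℝ g (x - ((1 - 1 / θ) • (x' - M • g') + (1 / θ) • z)) = 0 := by
    rw [h, mul_zero]
  simp only [inner_sub_right, inner_add_right, inner_smul_right, norm_sub_sq_real] at h' ⊢
  field_simp at h'
  linear_combination -h'

variable {d : ℕ} {L R : ℝ} {N : ℕ} {f : EuclideanSpace ℝ (Fin d) → ℝ}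
  {x g : ℕ → EuclideanSpace ℝ (Fin d)}

theorem zero_mem_subdiff {xs : EuclideanSpace ℝ (Fin d)} (h : ∀ y, f xs ≤ f y) :
    0 ∈ subdiff f xs := fun y => by simpa using h y

/-- The point `x₀ - (2 / L) ∑_{j < i} θ_j g_j`. -/
noncomputable def ogmZ (L : ℝ) (N : ℕ) (x g : ℕ → EuclideanSpace ℝ (Fin d)) (i : ℕ) :
    EuclideanSpace ℝ (Fin d) :=
  x 0 - (2 / L) • ∑ j ∈ Finset.range i, ogmTheta N j • g j

theorem ogmZ_succ (i : ℕ) :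
    ogmZ L N x g (i + 1) = ogmZ L N x g i - (2 / L * ogmTheta N i) • g i := by
  simp only [ogmZ, Finset.sum_range_succ, smul_add, smul_smul]
  abel

theorem norm_sub_smul_sub_sq (z v xs : EuclideanSpace ℝ (Fin d)) (c : ℝ) :
    ‖z - c • v - xs‖ ^ 2 = ‖z - xs‖ ^ 2 - 2 * c * inner ℝ v (z - xs) + c ^ 2 * ‖v‖ ^ 2 := by
  rw [sub_right_comm, norm_sub_sq_real, inner_smul_right, norm_smul, mul_pow, Real.norm_eq_abs,
    sq_abs, real_inner_comm]
  ring

/-- The weights θ² - θ and θ add up to θ², the coefficient of f(x_{i+1}); `ogm_step_identity` turns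
the weighted inner products into one involving only z_{i+1} - x_*. -/
theorem SatisfiesOGMRelation.combination_le (hL : 0 < L) (hf : f ∈ smoothConvex d L)
    {xs : EuclideanSpace ℝ (Fin d)} (hxs : ∀ y, f xs ≤ f y) (hg : ∀ i ≤ N, g i ∈ subdiff f (x i))
    (hrel : SatisfiesOGMRelation L N x g) {i : ℕ} (hi : i + 1 ≤ N) {θ : ℝ}
    (hθ : ogmTheta N (i + 1) = θ) :
    θ ^ 2 * (f (x (i + 1)) - f xs + (1 / L) / 2 * ‖g (i + 1)‖ ^ 2)
      ≤ (θ ^ 2 - θ) * (f (x i) - f xs - (1 / L) / 2 * ‖g i‖ ^ 2)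
        + θ * inner ℝ (g (i + 1)) (ogmZ L N x g (i + 1) - xs) := by
  have h1 : 1 ≤ θ := hθ ▸ one_le_ogmTheta N (i + 1)
  have hr := hrel (i + 1) (by omega) hi
  rw [hθ, Nat.add_sub_cancel] at hr
  have hid := ogm_step_identity (by linarith) _ _ _ _ _ xs hr
  have hA := smoothConvex.cocoercive hL hf (hg _ hi) (hg i (by omega))
  have hB := smoothConvex.cocoercive hL hf (hg _ hi) (zero_mem_subdiff hxs)
  rw [sub_zero] at hB
  have hA' := mul_le_mul_of_nonneg_left hA (show 0 ≤ θ ^ 2 - θ by nlinarith)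
  have hB' := mul_le_mul_of_nonneg_left hB (show 0 ≤ θ by linarith)
  change _ = _ + _ - θ * inner ℝ (g (i + 1)) (ogmZ L N x g (i + 1) - xs) at hid
  linarith

/-- The potential of the optimized gradient method before the last step. -/
theorem SatisfiesOGMRelation.potential_le (hL : 0 < L) (hf : f ∈ smoothConvex d L)
    {xs : EuclideanSpace ℝ (Fin d)} (hxs : ∀ y, f xs ≤ f y) (hg : ∀ i ≤ N, g i ∈ subdiff f (x i))
    (hrel : SatisfiesOGMRelation L N x g) {i : ℕ} (hi : i < N) :
    2 * ogmTheta N i ^ 2 * (f (x i) - f xs - (1 / L) / 2 * ‖g i‖ ^ 2)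
      + L / 2 * ‖ogmZ L N x g (i + 1) - xs‖ ^ 2 ≤ L / 2 * ‖x 0 - xs‖ ^ 2 := by
  have hz : ∀ i, L / 2 * ‖ogmZ L N x g (i + 1) - xs‖ ^ 2 = L / 2 * ‖ogmZ L N x g i - xs‖ ^ 2
      - 2 * ogmTheta N i * inner ℝ (g i) (ogmZ L N x g i - xs)
      + 4 * ogmTheta N i ^ 2 * ((1 / L) / 2 * ‖g i‖ ^ 2) := fun i => by
    rw [ogmZ_succ, norm_sub_smul_sub_sq]
    field_simp
    ring
  induction i with
  | zero =>
    have hB := smoothConvex.cocoercive hL hf (hg 0 hi.le) (zero_mem_subdiff hxs)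
    rw [hz]
    simp only [ogmZ, ogmTheta, Finset.range_zero, Finset.sum_empty, smul_zero, sub_zero] at hB ⊢
    rw [← neg_sub xs (x 0), inner_neg_right]
    linarith
  | succ i ih =>
    have hc := hrel.combination_le hL hf hxs hg hi.le rfl
    rw [ogmTheta_succ_sq hi.ne] at hc
    have := ih (by omega)
    rw [hz]
    -- Twice `hc` plus `hz`: the inner products with z_{i+1} - x_* cancel.
    linarith

theorem SatisfiesOGMRelation.sub_iInf_le (hL : 0 ≤ L)
    {x₀ : EuclideanSpace ℝ (Fin d)} (hin : IsInput (smoothConvex d L) R f x₀)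
    (htr : IsTrajectory f x₀ N x g) (hrel : SatisfiesOGMRelation L N x g) :
    f (x N) - ⨅ y, f y ≤ L * R ^ 2 / (2 * ogmTheta N N ^ 2) := by
  obtain ⟨hf, xs, hxs, hd⟩ := hin
  obtain ⟨rfl, hg⟩ := htr
  have hinf : ⨅ y, f y = f xs :=
    le_antisymm (ciInf_le ⟨f xs, by rintro _ ⟨y, rfl⟩; exact hxs y⟩ xs) (le_ciInf hxs)
  have hθ := one_le_ogmTheta N N
  rw [hinf]
  rcases hL.eq_or_lt with rfl | hL
  -- For L = 0 the descent lemma at the minimizer already gives f(x_N) ≤ f_*.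
  · have := smoothConvex.le_quadratic_of_mem_subdiff hf (zero_mem_subdiff hxs) (x N)
    simp at this ⊢
    exact this
  have hsq : L / 2 * ‖x 0 - xs‖ ^ 2 ≤ L / 2 * R ^ 2 := by gcongr
  rw [le_div_iff₀ (by positivity)]
  suffices h : ogmTheta N N ^ 2 * (f (x N) - f xs) ≤ L / 2 * ‖x 0 - xs‖ ^ 2 by linarith
  rcases N with _ | n
  · have := smoothConvex.le_quadratic_of_mem_subdiff hf (zero_mem_subdiff hxs) (x 0)
    simp [ogmTheta] at this ⊢
    linarith
  · have hc := hrel.combination_le hL hf hxs hg le_rfl rfl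
    rw [ogmTheta_last_sq rfl] at hc
    have hp := hrel.potential_le hL hf hxs hg (Nat.lt_succ_self n)
    -- The step is θ_N/L, half of the 2θ_N/L used in z, so that the cross term cancels the one in
    -- `hc` without doubling.
    have hn : 0 ≤ L / 2 * ‖ogmZ L (n + 1) x g (n + 1) - (1 / L * ogmTheta (n + 1) (n + 1)) •
      g (n + 1) - xs‖ ^ 2 := by positivity
    rw [norm_sub_smul_sub_sq] at hn
    have e : L / 2 * (‖ogmZ L (n + 1) x g (n + 1) - xs‖ ^ 2 - 2 * (1 / L * ogmTheta (n + 1) (n + 1))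
        * inner ℝ (g (n + 1)) (ogmZ L (n + 1) x g (n + 1) - xs)
        + (1 / L * ogmTheta (n + 1) (n + 1)) ^ 2 * ‖g (n + 1)‖ ^ 2) =
        L / 2 * ‖ogmZ L (n + 1) x g (n + 1) - xs‖ ^ 2
        - ogmTheta (n + 1) (n + 1) * inner ℝ (g (n + 1)) (ogmZ L (n + 1) x g (n + 1) - xs)
        + ogmTheta (n + 1) (n + 1) ^ 2 * ((1 / L) / 2 * ‖g (n + 1)‖ ^ 2) := by
      field_simp
    rw [e] at hn
    linarith

end UpperBound

/-! ### The methods satisfy the orthogonality relations -/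

section Relation

variable {d : ℕ} {L : ℝ} {N : ℕ} {f : EuclideanSpace ℝ (Fin d) → ℝ}
  {x₀ : EuclideanSpace ℝ (Fin d)} {x g : ℕ → EuclideanSpace ℝ (Fin d)}

/-- The vector paired with g_i lies in the span of g_0, …, g_{i-1}, to which g_i is orthogonal; so
the relation holds for any L. -/
theorem IsGFOM.satisfiesOGMRelation (h : IsGFOM f x₀ N x g) (L : ℝ) :
    SatisfiesOGMRelation L N x g := by
  obtain ⟨⟨rfl, -⟩, h⟩ := h
  intro i hi hiN
  have hgS : ∀ j < i, g j ∈ Submodule.span ℝ (g '' Set.Iio i) := fun j hj =>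
    Submodule.subset_span ⟨j, hj, rfl⟩
  have hxS : ∀ j ≤ i, x j - x 0 ∈ Submodule.span ℝ (g '' Set.Iio i) := fun j hj => by
    rcases Nat.eq_zero_or_pos j with rfl | hj0
    · simp
    · exact Submodule.span_mono (Set.image_mono (Set.Iio_subset_Iio hj))
        (h j hj0 (hj.trans hiN)).1.1
  have horth : ∀ v ∈ Submodule.span ℝ (g '' Set.Iio i), inner ℝ (g i) v = 0 := fun v hv => by
    induction hv using Submodule.span_induction with
    | mem v hv => obtain ⟨j, hj, rfl⟩ := hv; exact (h i hi hiN).2 j hj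
    | zero => simp
    | add u v _ _ hu hv => rw [inner_add_right, hu, hv, add_zero]
    | smul c v _ hv => rw [inner_smul_right, hv, mul_zero]
  apply horth
  have e : x i - ((1 - 1 / ogmTheta N i) • (x (i - 1) - (1 / L) • g (i - 1)) +
        (1 / ogmTheta N i) • (x 0 - (2 / L) • ∑ j ∈ Finset.range i, ogmTheta N j • g j))
      = (x i - x 0) - (1 - 1 / ogmTheta N i) • ((x (i - 1) - x 0) - (1 / L) • g (i - 1))
        + (1 / ogmTheta N i) • (2 / L) • ∑ j ∈ Finset.range i, ogmTheta N j • g j := by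
    module
  rw [e]
  refine add_mem (sub_mem (hxS i le_rfl) (Submodule.smul_mem _ _ (sub_mem (hxS _ (by omega))
    (Submodule.smul_mem _ _ (hgS _ (by omega)))))) (Submodule.smul_mem _ _ (Submodule.smul_mem _ _
    (sum_mem fun j hj => Submodule.smul_mem _ _ (hgS j (Finset.mem_range.1 hj)))))

theorem sub_ogm_bracket (L : ℝ) (i : ℕ) :
    x i - ((1 - 1 / ogmTheta N i) • (x (i - 1) - (1 / L) • g (i - 1)) +
      (1 / ogmTheta N i) • (x 0 - (2 / L) • ∑ j ∈ Finset.range i, ogmTheta N j • g j))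
      = x i - (ogmY N x i - (1 / L) • ogmD N g i) := by
  simp only [ogmY, ogmD]
  module

theorem IsOGM.satisfiesOGMRelation (h : IsOGM L f x₀ N x g) : SatisfiesOGMRelation L N x g :=
  fun i hi hiN => by rw [sub_ogm_bracket, ← h.2 i hi hiN, sub_self, inner_zero_right]

/-- Exact line search makes g_i orthogonal to d_i, and x_i differs from the plain OGM point only by
a multiple of d_i. -/
theorem IsOGMLS.satisfiesOGMRelation (hf : f ∈ smoothConvex d L) (h : IsOGMLS f x₀ N x g) :
    SatisfiesOGMRelation L N x g := fun i hi hiN => by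
  obtain ⟨α, hα, hx⟩ := h.2 i hi hiN
  have h0 : inner ℝ (g i) (ogmD N g i) = 0 := by
    refine smoothConvex.inner_eq_zero_of_line_min hf (h.1.2 i hiN) fun s => ?_
    have := hα (α - s)
    rw [← hx] at this
    convert this using 2
    rw [hx]
    module
  have e : x i - (ogmY N x i - (1 / L) • ogmD N g i) = (1 / L - α) • ogmD N g i := by
    rw [hx]; module
  rw [sub_ogm_bracket, e, inner_smul_right, h0, mul_zero]

end Relation

/-! ### Moreau envelopes -/

section MoreauEnvelope

variable {d : ℕ} {L : ℝ}

/-- A function with an interpolation inequality at all pairs of points is smooth and convex. -/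
theorem mem_smoothConvex_of_interpolation (hL : 0 < L) {f : EuclideanSpace ℝ (Fin d) → ℝ}
    {G : EuclideanSpace ℝ (Fin d) → EuclideanSpace ℝ (Fin d)}
    (h : ∀ x y, f x + inner ℝ (G x) (y - x) + (1 / L) / 2 * ‖G x - G y‖ ^ 2 ≤ f y) :
    f ∈ smoothConvex d L := by
  have hsub : ∀ x y, f x + inner ℝ (G x) (y - x) ≤ f y := fun x y => by
    have : 0 ≤ (1 / L) / 2 * ‖G x - G y‖ ^ 2 := by positivity
    linarith [h x y]
  have hlip : ∀ x y, ‖G x - G y‖ ≤ L * ‖x - y‖ := fun x y => by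
    have h1 := h x y
    have h2 := h y x
    have h3 := real_inner_le_norm (G x - G y) (x - y)
    rw [norm_sub_rev (G y)] at h2
    have e : inner ℝ (G x - G y) (x - y) = -inner ℝ (G x) (y - x) - inner ℝ (G y) (x - y) := by
      rw [inner_sub_left, ← neg_sub y x, inner_neg_right]
    have h4 : 1 / L * ‖G x - G y‖ ^ 2 ≤ ‖G x - G y‖ * ‖x - y‖ := by linarith
    rw [one_div, inv_mul_le_iff₀ hL] at h4
    rcases (norm_nonneg (G x - G y)).eq_or_lt with h0 | h0
    · rw [← h0]; positivity
    · exact le_of_mul_le_mul_left (by linarith) h0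
  have hgrad : ∀ x, HasGradientAt f (G x) x := fun x => by
    rw [hasGradientAt_iff_isLittleO]
    -- The remainder lies between 0 and ⟨G y - G x, y - x⟩ ≤ L‖y - x‖².
    have : (fun y => f y - f x - inner ℝ (G x) (y - x)) =O[nhds x] fun y => ‖y - x‖ ^ 2 := by
      refine Asymptotics.IsBigO.of_bound L (Filter.Eventually.of_forall fun y => ?_)
      have h1 := hsub x y
      have h2 := hsub y x
      have h3 := real_inner_le_norm (G y - G x) (y - x)
      have h4 := mul_le_mul_of_nonneg_right (hlip y x) (norm_nonneg (y - x))
      rw [inner_sub_left, ← neg_sub x y, inner_neg_right, inner_neg_right] at h3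
      rw [← neg_sub x y, inner_neg_right] at h1
      rw [Real.norm_of_nonneg (by rw [← neg_sub x y, inner_neg_right]; linarith),
        Real.norm_of_nonneg (by positivity), ← neg_sub x y, inner_neg_right]
      rw [← neg_sub x y] at h4
      nlinarith
    refine this.trans_isLittleO ?_
    have hlo : (fun v : EuclideanSpace ℝ (Fin d) => ‖v‖ ^ 2) =o[nhds 0] fun v => v :=
      Asymptotics.isLittleO_norm_pow_id one_lt_two
    have ht : Filter.Tendsto (fun y => y - x) (nhds x) (nhds 0) := by
      have : Continuous fun y => y - x := by fun_prop
      simpa using this.tendsto x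
    exact hlo.comp_tendsto ht
  refine ⟨⟨convex_univ, fun x _ y _ a b ha hb hab => ?_⟩,
    fun x => (hgrad x).differentiableAt, fun x y => ?_⟩
  · have h1 := mul_le_mul_of_nonneg_left (hsub (a • x + b • y) x) ha
    have h2 := mul_le_mul_of_nonneg_left (hsub (a • x + b • y) y) hb
    have e : a * inner ℝ (G (a • x + b • y)) (x - (a • x + b • y))
        + b * inner ℝ (G (a • x + b • y)) (y - (a • x + b • y)) = 0 := by
      rw [← inner_smul_right, ← inner_smul_right, ← inner_add_right]
      have : a • (x - (a • x + b • y)) + b • (y - (a • x + b • y)) = 0 := by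
        obtain rfl : b = 1 - a := by linarith
        module
      rw [this, inner_zero_right]
    have e2 : (a + b) * f (a • x + b • y) = f (a • x + b • y) := by rw [hab, one_mul]
    simp only [smul_eq_mul]
    linarith
  · rw [(hgrad x).gradient, (hgrad y).gradient]
    exact hlip x y

/-- The point u minimizes p(v) + (L/2)‖x - v‖², coercive because p ≥ 0; comparing u with (1 - s)u +
sv as s → 0 gives the subgradient inequality. -/
theorem exists_prox (hL : 0 < L) {p : EuclideanSpace ℝ (Fin d) → ℝ} (hp : ConvexOn ℝ Set.univ p)
    (hc : Continuous p) (h0 : ∀ u, 0 ≤ p u) (x : EuclideanSpace ℝ (Fin d)) :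
    ∃ u, L • (x - u) ∈ subdiff p u := by
  obtain ⟨u, hu⟩ : ∃ u, ∀ v, p u + L / 2 * ‖x - u‖ ^ 2 ≤ p v + L / 2 * ‖x - v‖ ^ 2 := by
    refine Continuous.exists_forall_le (by fun_prop) ?_
    have h1 : Filter.Tendsto (fun v : EuclideanSpace ℝ (Fin d) => ‖x - v‖)
        (Filter.cocompact _) Filter.atTop := by
      have := tendsto_norm_cocompact_atTop (E := EuclideanSpace ℝ (Fin d))
      exact this.comp (Homeomorph.subLeft x).isClosedEmbedding.tendsto_cocompact
    have h2 : Filter.Tendsto (fun v : EuclideanSpace ℝ (Fin d) => L / 2 * ‖x - v‖ ^ 2)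
        (Filter.cocompact _) Filter.atTop :=
      ((Filter.tendsto_pow_atTop two_ne_zero).comp h1).const_mul_atTop (by positivity)
    exact Filter.tendsto_atTop_mono (fun v => by linarith [h0 v]) h2
  refine ⟨u, fun v => ?_⟩
  suffices h : 0 ≤ p v - p u - L * inner ℝ (x - u) (v - u) by
    rw [inner_smul_left]; simp; linarith
  refine nonneg_of_forall_nonneg_add_mul (K := L / 2 * ‖v - u‖ ^ 2) fun s hs hs1 => ?_
  have h1 := hu ((1 - s) • u + s • v)
  have h2 := hp.2 (Set.mem_univ u) (Set.mem_univ v) (show 0 ≤ 1 - s by linarith) hs.le (by ring)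
  have e : x - ((1 - s) • u + s • v) = (x - u) - s • (v - u) := by module
  rw [e, norm_sub_sq_real (x - u), inner_smul_right, norm_smul, Real.norm_of_nonneg hs.le] at h1
  simp only [smul_eq_mul] at h2
  have h3 : 0 ≤ s * (p v - p u - L * inner ℝ (x - u) (v - u) + L / 2 * ‖v - u‖ ^ 2 * s) := by
    nlinarith
  exact nonneg_of_mul_nonneg_right h3 hs

/-- The Moreau envelope of a nonnegative continuous convex function, described by its value and
slope at the points above a given subgradient. -/
theorem exists_envelope (hL : 0 < L) {p : EuclideanSpace ℝ (Fin d) → ℝ}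
    (hp : ConvexOn ℝ Set.univ p) (hc : Continuous p) (h0 : ∀ u, 0 ≤ p u) :
    ∃ f ∈ smoothConvex d L, (∀ x, 0 ≤ f x) ∧ ∀ u g, g ∈ subdiff p u →
      f (u + (1 / L) • g) = p u + (1 / L) / 2 * ‖g‖ ^ 2 ∧ g ∈ subdiff f (u + (1 / L) • g) := by
  choose U hU using exists_prox hL hp hc h0
  let G := fun x => L • (x - U x)
  let f := fun x => p (U x) + (1 / L) / 2 * ‖G x‖ ^ 2
  have hUG : ∀ x, U x = x - (1 / L) • G x := fun x => by
    simp only [G, smul_smul, one_div_mul_cancel hL.ne', one_smul, sub_sub_cancel]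
  have hint : ∀ x y, f x + inner ℝ (G x) (y - x) + (1 / L) / 2 * ‖G x - G y‖ ^ 2 ≤ f y := by
    intro x y
    have h1 : p (U x) + inner ℝ (G x) (U y - U x) ≤ p (U y) := hU x (U y)
    have e : U y - U x = (y - x) + (1 / L) • (G x - G y) := by
      rw [hUG x, hUG y]; module
    rw [e, inner_add_right, inner_smul_right, inner_sub_right (G x) (G x),
      real_inner_self_eq_norm_sq] at h1
    simp only [f]
    rw [norm_sub_sq_real]
    linarith
  refine ⟨f, mem_smoothConvex_of_interpolation hL hint, fun x => ?_, fun u g hg => ?_⟩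
  · exact add_nonneg (h0 _) (by positivity)
  · set x := u + (1 / L) • g with hx
    -- Monotonicity of the subdifferential: adding the subgradient inequalities at u and U x gives
    -- L‖u - U x‖² ≤ 0.
    have hu : U x = u := by
      have h1 : p (U x) + inner ℝ (G x) (u - U x) ≤ p u := hU x u
      have h2 := hg (U x)
      have e : G x = L • (u - U x) + g := by
        simp only [G, hx]
        rw [add_sub_right_comm, smul_add, smul_smul, mul_one_div_cancel hL.ne', one_smul]
      rw [e, inner_add_left, inner_smul_left, real_inner_self_eq_norm_sq] at h1
      rw [← neg_sub u, inner_neg_right] at h2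
      have h3 : L * ‖u - U x‖ ^ 2 ≤ 0 := by simp at h1; linarith
      have h4 : ‖u - U x‖ ^ 2 = 0 := le_antisymm (by nlinarith) (sq_nonneg _)
      exact (sub_eq_zero.1 (norm_eq_zero.1 (pow_eq_zero_iff two_ne_zero |>.1 h4))).symm
    have hG : G x = g := by
      simp only [G, hu]
      rw [hx, add_sub_cancel_left, smul_smul, mul_one_div_cancel hL.ne', one_smul]
    refine ⟨by simp only [f, hu, hG], fun y => ?_⟩
    have h1 := hint x y
    rw [hG] at h1
    have : 0 ≤ (1 / L) / 2 * ‖g - G y‖ ^ 2 := by positivity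
    linarith

end MoreauEnvelope

/-! ### The worst-case function -/

section Tightness

variable {d : ℕ} {L : ℝ}

/-- The positive part of the maximum of `⟪g j, u⟫ + a j`, `j ≤ N`. -/
noncomputable def maxAffine (N : ℕ) (g : ℕ → EuclideanSpace ℝ (Fin d)) (a : ℕ → ℝ)
    (u : EuclideanSpace ℝ (Fin d)) : ℝ :=
  max 0 ((Finset.range (N + 1)).sup' Finset.nonempty_range_add_one fun j => inner ℝ (g j) u + a j)

theorem maxAffine_nonneg (N : ℕ) (g : ℕ → EuclideanSpace ℝ (Fin d)) (a : ℕ → ℝ)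
    (u : EuclideanSpace ℝ (Fin d)) : 0 ≤ maxAffine N g a u := le_max_left _ _

theorem le_maxAffine {N : ℕ} (g : ℕ → EuclideanSpace ℝ (Fin d)) (a : ℕ → ℝ)
    (u : EuclideanSpace ℝ (Fin d)) {j : ℕ} (hj : j ≤ N) :
    inner ℝ (g j) u + a j ≤ maxAffine N g a u :=
  le_max_of_le_right (Finset.le_sup' (fun j => inner ℝ (g j) u + a j)
    (Finset.mem_range.2 (Nat.lt_succ_of_le hj)))

theorem maxAffine_le {N : ℕ} {g : ℕ → EuclideanSpace ℝ (Fin d)} {a : ℕ → ℝ}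
    {u : EuclideanSpace ℝ (Fin d)} {c : ℝ} (hc : 0 ≤ c)
    (h : ∀ j ≤ N, inner ℝ (g j) u + a j ≤ c) : maxAffine N g a u ≤ c :=
  max_le hc (Finset.sup'_le _ _ fun j hj => h j (Nat.le_of_lt_succ (Finset.mem_range.1 hj)))

theorem continuous_maxAffine (N : ℕ) (g : ℕ → EuclideanSpace ℝ (Fin d)) (a : ℕ → ℝ) :
    Continuous (maxAffine N g a) :=
  continuous_const.max (Continuous.finset_sup'_apply _ fun j _ => by fun_prop)

theorem convexOn_maxAffine (N : ℕ) (g : ℕ → EuclideanSpace ℝ (Fin d)) (a : ℕ → ℝ) :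
    ConvexOn ℝ Set.univ (maxAffine N g a) := by
  refine ⟨convex_univ, fun u _ v _ s t hs ht hst => maxAffine_le ?_ fun j hj => ?_⟩
  · exact add_nonneg (mul_nonneg hs (maxAffine_nonneg ..)) (mul_nonneg ht (maxAffine_nonneg ..))
  · have h1 := mul_le_mul_of_nonneg_left (le_maxAffine g a u hj) hs
    have h2 := mul_le_mul_of_nonneg_left (le_maxAffine g a v hj) ht
    have e : (s + t) * a j = a j := by rw [hst, one_mul]
    simp only [inner_add_right, inner_smul_right, smul_eq_mul]
    linarith

/-- The execution of the greedy method whose `j`-th gradient is `g j`. -/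
noncomputable def chainPoint (g : ℕ → EuclideanSpace ℝ (Fin d)) (a : ℕ → ℝ) (i : ℕ) :
    EuclideanSpace ℝ (Fin d) :=
  -∑ j ∈ Finset.range i, (a j / ‖g j‖ ^ 2) • g j

theorem chainPoint_sub_mem (g : ℕ → EuclideanSpace ℝ (Fin d)) (a : ℕ → ℝ) (i : ℕ) :
    chainPoint g a i - chainPoint g a 0 ∈ Submodule.span ℝ (g '' Set.Iio i) := by
  simp only [chainPoint, Finset.range_zero, Finset.sum_empty, neg_zero, sub_zero]
  exact neg_mem (sum_mem fun j hj => Submodule.smul_mem _ _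
    (Submodule.subset_span ⟨j, Finset.mem_range.1 hj, rfl⟩))

/-- By orthogonality, step j alone affects piece j: its value is a_j before that step and 0
afterwards. -/
theorem inner_chainPoint {N : ℕ} {g : ℕ → EuclideanSpace ℝ (Fin d)} (a : ℕ → ℝ)
    (hpos : ∀ i ≤ N, 0 < ‖g i‖) (horth : ∀ i ≤ N, ∀ j ≤ N, i ≠ j → inner ℝ (g i) (g j) = 0)
    {i j : ℕ} (hi : i ≤ N + 1) (hj : j ≤ N) :
    inner ℝ (g j) (chainPoint g a i) = if j < i then -a j else 0 := by
  simp only [chainPoint, inner_neg_right, inner_sum, inner_smul_right]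
  have h0 : ∀ k ∈ Finset.range i, k ≠ j → a k / ‖g k‖ ^ 2 * inner ℝ (g j) (g k) = 0 :=
    fun k hk hkj => by
      rw [horth j hj k (by have := Finset.mem_range.1 hk; omega) hkj.symm, mul_zero]
  split_ifs with h
  · rw [Finset.sum_eq_single_of_mem j (Finset.mem_range.2 h) h0, real_inner_self_eq_norm_sq,
      div_mul_cancel₀ _ (pow_pos (hpos j hj) 2).ne']
  · rw [Finset.sum_eq_zero fun k hk => h0 k hk (by have := Finset.mem_range.1 hk; omega), neg_zero]

theorem norm_chainPoint_sq {N : ℕ} {g : ℕ → EuclideanSpace ℝ (Fin d)} (a : ℕ → ℝ)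
    (hpos : ∀ i ≤ N, 0 < ‖g i‖) (horth : ∀ i ≤ N, ∀ j ≤ N, i ≠ j → inner ℝ (g i) (g j) = 0) :
    ‖chainPoint g a (N + 1)‖ ^ 2 = ∑ j ∈ Finset.range (N + 1), a j ^ 2 / ‖g j‖ ^ 2 := by
  rw [← real_inner_self_eq_norm_sq]
  nth_rw 1 [chainPoint]
  rw [inner_neg_left, sum_inner, ← Finset.sum_neg_distrib]
  refine Finset.sum_congr rfl fun j hj => ?_
  have hj := Finset.mem_range.1 hj
  rw [inner_smul_left, inner_chainPoint a hpos horth le_rfl (by omega), if_pos hj]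
  simp
  ring

/-- Orthogonal gradients `g 0, …, g N` and levels `a` with `a j ≤ a i - ‖g i‖² / L` for `i < j`
are realised by an execution of the greedy method. -/
theorem exists_isGFOM {N : ℕ} (hL : 0 < L) {g : ℕ → EuclideanSpace ℝ (Fin d)} {a : ℕ → ℝ}
    (hpos : ∀ i ≤ N, 0 < ‖g i‖) (horth : ∀ i ≤ N, ∀ j ≤ N, i ≠ j → inner ℝ (g i) (g j) = 0)
    (hlev : ∀ i j, i < j → j ≤ N → a j ≤ a i - (1 / L) * ‖g i‖ ^ 2)
    (hlev0 : ∀ i ≤ N, 0 ≤ a i - (1 / L) * ‖g i‖ ^ 2) :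
    ∃ f, IsInput (smoothConvex d L) ‖chainPoint g a (N + 1)‖ f 0 ∧
      IsGFOM f 0 N (chainPoint g a) g ∧
      f (chainPoint g a N) - ⨅ y, f y = a N - (1 / L) / 2 * ‖g N‖ ^ 2 := by
  obtain ⟨f, hf, hf0, henv⟩ := exists_envelope hL (convexOn_maxAffine N g a)
    (continuous_maxAffine N g a) (maxAffine_nonneg N g a)
  -- At this shifted point the pieces j < i equal 0, piece i has dropped by ‖g_i‖²/L, and the pieces
  -- j > i still equal a_j; the level conditions make piece i maximal. The envelope transports its
  -- slope g_i to the i-th chain point.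
  have hval : ∀ i ≤ N, maxAffine N g a (chainPoint g a i - (1 / L) • g i)
      = a i - (1 / L) * ‖g i‖ ^ 2 := by
    intro i hi
    refine le_antisymm (maxAffine_le (hlev0 i hi) fun j hj => ?_) ?_
    · rw [inner_sub_right, inner_smul_right, inner_chainPoint a hpos horth (by omega) hj]
      rcases lt_trichotomy j i with h | rfl | h
      · rw [if_pos h, horth j hj i hi h.ne]
        linarith [hlev0 i hi]
      · rw [if_neg (lt_irrefl _), real_inner_self_eq_norm_sq]
        linarith
      · rw [if_neg h.not_gt, horth j hj i hi h.ne']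
        linarith [hlev i j h hj]
    · refine le_trans ?_ (le_maxAffine g a _ hi)
      rw [inner_sub_right, inner_smul_right, inner_chainPoint a hpos horth (by omega) hi,
        if_neg (lt_irrefl _), real_inner_self_eq_norm_sq]
      linarith
  have hsub : ∀ i ≤ N, g i ∈ subdiff (maxAffine N g a) (chainPoint g a i - (1 / L) • g i) := by
    intro i hi v
    have h1 := le_maxAffine g a v hi
    rw [hval i hi, inner_sub_right, inner_sub_right, inner_smul_right,
      inner_chainPoint a hpos horth (by omega) hi, if_neg (lt_irrefl _), real_inner_self_eq_norm_sq]
    linarith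
  have hstar : maxAffine N g a (chainPoint g a (N + 1)) = 0 :=
    le_antisymm (maxAffine_le le_rfl fun j hj => by
      rw [inner_chainPoint a hpos horth le_rfl hj, if_pos (by omega)]; linarith)
      (maxAffine_nonneg ..)
  have hmin : f (chainPoint g a (N + 1)) = 0 := by
    have := (henv (chainPoint g a (N + 1)) 0 fun v => by
      rw [hstar]; simpa using maxAffine_nonneg N g a v).1
    simpa [hstar] using this
  have hinf : ⨅ y, f y = 0 :=
    le_antisymm (hmin ▸ ciInf_le ⟨0, by rintro _ ⟨y, rfl⟩; exact hf0 y⟩ _) (le_ciInf hf0)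
  have hgf : ∀ i ≤ N, g i ∈ subdiff f (chainPoint g a i) := fun i hi => by
    simpa using (henv _ _ (hsub i hi)).2
  have hx0 : chainPoint g a 0 = 0 := by simp [chainPoint]
  refine ⟨f, ⟨hf, chainPoint g a (N + 1), fun y => hmin ▸ hf0 y, by simp⟩,
    ⟨⟨hx0, hgf⟩, fun i _ hi => ⟨⟨hx0 ▸ chainPoint_sub_mem g a i, fun y hy => ?_⟩,
      fun j hj => horth i hi j (by omega) hj.ne'⟩⟩, ?_⟩
  · have horthS : ∀ v ∈ Submodule.span ℝ (g '' Set.Iio i), inner ℝ (g i) v = 0 := fun v hv => by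
      induction hv using Submodule.span_induction with
      | mem v hv =>
        obtain ⟨j, hj, rfl⟩ := hv
        have hj : j < i := hj
        exact horth i hi j (by omega) hj.ne'
      | zero => simp
      | add u v _ _ hu hv => rw [inner_add_right, hu, hv, add_zero]
      | smul c v _ hv => rw [inner_smul_right, hv, mul_zero]
    have h1 := hgf i hi y
    have h2 := horthS _ (sub_mem hy (hx0 ▸ chainPoint_sub_mem g a i))
    rw [sub_sub_sub_cancel_right] at h2
    linarith
  · have := (henv _ _ (hsub N le_rfl)).1
    rw [sub_add_cancel, hval N le_rfl] at this
    rw [hinf, this]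
    ring

/-- The levels of the worst-case function, up to scaling. -/
noncomputable def ogmLevel (N i : ℕ) : ℝ := ∏ j ∈ Finset.range i, (1 - 1 / (2 * ogmTheta N j))

/-- The drops of the levels of the worst-case function, up to scaling. -/
noncomputable def ogmDrop (N i : ℕ) : ℝ :=
  if i = N then ogmLevel N i / ogmTheta N i else ogmLevel N i / (2 * ogmTheta N i)

theorem one_sub_inv_two_ogmTheta_mem (N j : ℕ) : 1 - 1 / (2 * ogmTheta N j) ∈ Set.Ioo 0 1 := by
  have h := one_le_ogmTheta N j
  constructor
  · rw [sub_pos, div_lt_one (by linarith)]; linarith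
  · rw [sub_lt_self_iff]; positivity

theorem ogmLevel_pos (N i : ℕ) : 0 < ogmLevel N i :=
  Finset.prod_pos fun j _ => (one_sub_inv_two_ogmTheta_mem N j).1

theorem ogmLevel_succ (N i : ℕ) :
    ogmLevel N (i + 1) = ogmLevel N i - ogmLevel N i / (2 * ogmTheta N i) := by
  rw [ogmLevel, Finset.prod_range_succ, ← ogmLevel]
  ring

theorem antitone_ogmLevel (N : ℕ) : Antitone (ogmLevel N) := antitone_nat_of_succ_le fun i => by
  have h := one_le_ogmTheta N i
  have := ogmLevel_pos N i
  rw [ogmLevel_succ]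
  exact sub_le_self _ (by positivity)

theorem ogmDrop_pos (N i : ℕ) : 0 < ogmDrop N i := by
  have h := one_le_ogmTheta N i
  have := ogmLevel_pos N i
  unfold ogmDrop
  split_ifs <;> positivity

theorem ogmLevel_le_sub_ogmDrop {N i j : ℕ} (hij : i < j) (hj : j ≤ N) :
    ogmLevel N j ≤ ogmLevel N i - ogmDrop N i := by
  rw [ogmDrop, if_neg (by omega), ← ogmLevel_succ]
  exact antitone_ogmLevel N hij

theorem ogmDrop_le_ogmLevel (N i : ℕ) : ogmDrop N i ≤ ogmLevel N i := by
  have h := one_le_ogmTheta N i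
  have := ogmLevel_pos N i
  unfold ogmDrop
  split_ifs
  · exact div_le_self this.le h
  · exact div_le_self this.le (by linarith)

/-- Telescoping: the right side at n equals (4θ_n² - 2θ_n) times level n, and θ_n² - θ_n = θ_{n-1}²
makes its increment 2θ_n times that level. -/
theorem sum_ogmTheta_mul_ogmLevel {N n : ℕ} (h : n < N) :
    ∑ i ∈ Finset.range (n + 1), 2 * ogmTheta N i * ogmLevel N i
      = 4 * ogmTheta N n ^ 2 * ogmLevel N (n + 1) := by
  induction n with
  | zero => simp [ogmLevel, ogmTheta]; norm_num
  | succ n ih =>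
    have h1 := one_le_ogmTheta N (n + 1)
    have e : 4 * ogmTheta N (n + 1) ^ 2 * ogmLevel N (n + 1 + 1) =
        (4 * ogmTheta N (n + 1) ^ 2 - 2 * ogmTheta N (n + 1)) * ogmLevel N (n + 1) := by
      rw [ogmLevel_succ]
      field_simp
      ring
    rw [Finset.sum_range_succ, ih (by omega), e, ← ogmTheta_succ_sq h.ne]
    ring

theorem sum_ogmLevel_sq_div_ogmDrop (N : ℕ) :
    ∑ i ∈ Finset.range (N + 1), ogmLevel N i ^ 2 / ogmDrop N i
      = ogmLevel N N * (2 * ogmTheta N N ^ 2 - ogmTheta N N) := by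
  have hlast : ogmLevel N N ^ 2 / ogmDrop N N = ogmTheta N N * ogmLevel N N := by
    have := one_le_ogmTheta N N
    have := ogmLevel_pos N N
    rw [ogmDrop, if_pos rfl]
    field_simp
  have hstep : ∀ i ∈ Finset.range N, ogmLevel N i ^ 2 / ogmDrop N i
      = 2 * ogmTheta N i * ogmLevel N i := fun i hi => by
    have := one_le_ogmTheta N i
    have := ogmLevel_pos N i
    rw [ogmDrop, if_neg (Finset.mem_range.1 hi).ne]
    field_simp
  rw [Finset.sum_range_succ, hlast, Finset.sum_congr rfl hstep]
  rcases N with _ | n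
  · simp [ogmTheta]; ring
  · rw [sum_ogmTheta_mul_ogmLevel (Nat.lt_succ_self n)]
    linear_combination -2 * ogmLevel (n + 1) (n + 1) * ogmTheta_last_sq (N := n + 1) (i := n) rfl

/-- The right side is also the sum in `sum_ogmLevel_sq_div_ogmDrop`, which ties the final gap to the
squared distance. -/
theorem ogmLevel_sub_half_ogmDrop (N : ℕ) :
    (ogmLevel N N - ogmDrop N N / 2) * (2 * ogmTheta N N ^ 2)
      = ogmLevel N N * (2 * ogmTheta N N ^ 2 - ogmTheta N N) := by
  have := one_le_ogmTheta N N
  rw [ogmDrop, if_pos rfl]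
  field_simp

/-- The bound of the greedy method is attained in every dimension larger than `N`. -/
theorem exists_isGFOM_tight {R : ℝ} (hL : 0 < L) (hR : 0 < R) {N : ℕ} (hd : N < d) :
    ∃ f : EuclideanSpace ℝ (Fin d) → ℝ, IsInput (smoothConvex d L) R f 0 ∧
      ∃ x g : ℕ → EuclideanSpace ℝ (Fin d), IsGFOM f 0 N x g ∧
        f (x N) - ⨅ y, f y = L * R ^ 2 / (2 * ogmTheta N N ^ 2) := by
  have hθ := one_le_ogmTheta N N
  set S := ogmLevel N N * (2 * ogmTheta N N ^ 2 - ogmTheta N N) with hS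
  have hSpos : 0 < S := mul_pos (ogmLevel_pos N N) (by nlinarith)
  -- The squared distance from 0 to the minimizer will be A S / L, so this A makes it R².
  set A := L * R ^ 2 / S with hA
  have hApos : 0 < A := by positivity
  let a : ℕ → ℝ := fun i => A * ogmLevel N i
  let g : ℕ → EuclideanSpace ℝ (Fin d) := fun i =>
    if h : i < d then √(L * (A * ogmDrop N i)) • EuclideanSpace.single ⟨i, h⟩ 1 else 0
  have hnorm : ∀ i ≤ N, ‖g i‖ ^ 2 = L * (A * ogmDrop N i) := fun i hi => by
    have := ogmDrop_pos N i
    simp only [g, dif_pos (lt_of_le_of_lt hi hd), norm_smul, PiLp.norm_single]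
    rw [norm_one, mul_one, Real.norm_of_nonneg (Real.sqrt_nonneg _), Real.sq_sqrt (by positivity)]
  have hnorm' : ∀ i ≤ N, 1 / L * ‖g i‖ ^ 2 = A * ogmDrop N i := fun i hi => by
    rw [hnorm i hi]; field_simp
  have hpos : ∀ i ≤ N, 0 < ‖g i‖ := fun i hi => by
    have := ogmDrop_pos N i
    have h2 : 0 < ‖g i‖ ^ 2 := by rw [hnorm i hi]; positivity
    exact (norm_nonneg _).lt_of_ne fun h => by simp [← h] at h2
  have horth : ∀ i ≤ N, ∀ j ≤ N, i ≠ j → inner ℝ (g i) (g j) = 0 := fun i hi j hj hij => by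
    simp only [g, dif_pos (lt_of_le_of_lt hi hd), dif_pos (lt_of_le_of_lt hj hd), inner_smul_left,
      inner_smul_right, EuclideanSpace.inner_single_left]
    simp [hij]
  obtain ⟨f, hin, hgf, hval⟩ := exists_isGFOM (N := N) (a := a) hL hpos horth
    (fun i j hij hj => by
      rw [hnorm' i (by omega), ← mul_sub]
      exact mul_le_mul_of_nonneg_left (ogmLevel_le_sub_ogmDrop hij hj) hApos.le)
    (fun i hi => by
      rw [hnorm' i hi, ← mul_sub]
      exact mul_nonneg hApos.le (sub_nonneg.2 (ogmDrop_le_ogmLevel N i)))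
  have hdist : ‖chainPoint g a (N + 1)‖ = R := by
    have h1 : ‖chainPoint g a (N + 1)‖ ^ 2 = R ^ 2 := by
      rw [norm_chainPoint_sq a hpos horth]
      have : ∀ i ∈ Finset.range (N + 1), a i ^ 2 / ‖g i‖ ^ 2
          = A / L * (ogmLevel N i ^ 2 / ogmDrop N i) := fun i hi => by
        have := ogmDrop_pos N i
        rw [hnorm i (Nat.le_of_lt_succ (Finset.mem_range.1 hi))]
        simp only [a]
        field_simp
      rw [Finset.sum_congr rfl this, ← Finset.mul_sum, sum_ogmLevel_sq_div_ogmDrop, ← hS, hA]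
      field_simp
    exact (pow_left_inj₀ (norm_nonneg _) hR.le two_ne_zero).1 h1
  refine ⟨f, hdist ▸ hin, _, g, hgf, ?_⟩
  rw [hval, eq_div_iff (by positivity)]
  have h1 : a N - 1 / L / 2 * ‖g N‖ ^ 2 = A * (ogmLevel N N - ogmDrop N N / 2) := by
    have := hnorm' N le_rfl
    simp only [a]
    linear_combination -(1 / 2) * this
  rw [h1, mul_assoc, ogmLevel_sub_half_ogmDrop, ← hS, hA]
  field_simp

end Tightness

theorem mainTheorem7 (L R : ℝ) (hL : 0 ≤ L) (hR : 0 ≤ R) (N : ℕ) :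
    -- the bound for the greedy first-order method
    (∀ (d : ℕ) (f : EuclideanSpace ℝ (Fin d) → ℝ) (x₀ : EuclideanSpace ℝ (Fin d)),
      IsInput (smoothConvex d L) R f x₀ →
      ∀ x g : ℕ → EuclideanSpace ℝ (Fin d), IsGFOM f x₀ N x g →
        f (x N) - ⨅ y, f y ≤ L * R ^ 2 / (2 * ogmTheta N N ^ 2)) ∧
    -- its tightness in dimension at least `2 N + 2`
    (∀ d : ℕ, 2 * N + 2 ≤ d → ∀ ε : ℝ, 0 < ε →
      ∃ (f : EuclideanSpace ℝ (Fin d) → ℝ) (x₀ : EuclideanSpace ℝ (Fin d)),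
        IsInput (smoothConvex d L) R f x₀ ∧
        ∃ x g : ℕ → EuclideanSpace ℝ (Fin d), IsGFOM f x₀ N x g ∧
          L * R ^ 2 / (2 * ogmTheta N N ^ 2) - ε ≤ f (x N) - ⨅ y, f y) ∧
    -- the bound for all sequences satisfying the orthogonality relations
    (∀ (d : ℕ) (f : EuclideanSpace ℝ (Fin d) → ℝ) (x₀ : EuclideanSpace ℝ (Fin d)),
      IsInput (smoothConvex d L) R f x₀ →
      ∀ x g : ℕ → EuclideanSpace ℝ (Fin d), IsTrajectory f x₀ N x g →
        SatisfiesOGMRelation L N x g →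
        f (x N) - ⨅ y, f y ≤ L * R ^ 2 / (2 * ogmTheta N N ^ 2)) ∧
    -- the optimized gradient method, without and with exact line search, is covered
    (∀ (d : ℕ) (f : EuclideanSpace ℝ (Fin d) → ℝ) (x₀ : EuclideanSpace ℝ (Fin d)),
      IsInput (smoothConvex d L) R f x₀ →
      ∀ x g : ℕ → EuclideanSpace ℝ (Fin d), IsOGM L f x₀ N x g ∨ IsOGMLS f x₀ N x g →
        SatisfiesOGMRelation L N x g ∧
        f (x N) - ⨅ y, f y ≤ L * R ^ 2 / (2 * ogmTheta N N ^ 2)) := by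

  refine ⟨fun d f x₀ hin x g h => (h.satisfiesOGMRelation L).sub_iInf_le hL hin h.1,
    fun d hd ε hε => ?_, fun d f x₀ hin x g htr hrel => hrel.sub_iInf_le hL hin htr,
    fun d f x₀ hin x g h => ?_⟩
  -- If L R² = 0 the bound is 0, attained by the zero function with a constant execution.
  · by_cases h0 : L * R ^ 2 = 0
    · refine ⟨fun _ => 0, 0, ⟨⟨convexOn_const 0 convex_univ, differentiable_const 0, fun x y => ?_⟩,
        0, fun _ => le_rfl, by simpa using hR⟩, fun _ => 0, fun _ => 0,
        ⟨⟨rfl, fun i _ y => by simp⟩, fun i _ _ => ⟨⟨by simp, fun _ _ => le_rfl⟩, by simp⟩⟩, ?_⟩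
      · simp only [gradient_fun_const]
        simpa using mul_nonneg hL (norm_nonneg (x - y))
      · simp [h0, hε.le]
    · have hL' : 0 < L := lt_of_le_of_ne hL fun h => h0 (by simp [← h])
      have hR' : 0 < R := lt_of_le_of_ne hR fun h => h0 (by simp [← h])
      obtain ⟨f, hin, x, g, hgf, hval⟩ := exists_isGFOM_tight hL' hR' (show N < d by omega)
      exact ⟨f, 0, hin, x, g, hgf, by linarith⟩
  · have hrel : SatisfiesOGMRelation L N x g :=
      h.elim (fun h => h.satisfiesOGMRelation) fun h => h.satisfiesOGMRelation hin.1
    exact ⟨hrel, hrel.sub_iInf_le hL hin (h.elim (·.1) (·.1))⟩
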